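/- Let $\mathcal{H}$ be a complex Hilbert space with inner product linear in the second variable, and write $|x\rangle\langle y|$ for the operator $z\mapsto\langle y,z\rangle x$. Let $(T_t)_{t\ge 0}$ be a quantum Markov semigroup on $\mathcal{B}(\mathcal{H})$, that is, a semigroup ($T_0=\mathrm{id}$, $T_{t+s}=T_tT_s$) of $\sigma$-weakly continuous, completely positive linear maps with $T_t(1)=1$ such that $t\mapsto T_t(A)$ is $\sigma$-weakly continuous for every $A$. Let $L(A)=\lim_{t\to 0^+}\frac1t(T_tA-A)$ ($\sigma$-weak limit) be its generator, with domain $D(L)$ the set of all $A$ for which this limit exists, and let $\mathcal{A}$ be its domain algebra, i.e. the largest $*$-subalgebra of $\mathcal{B}(\mathcal{H})$ contained in $D(L)$; it exists and equals $\{A\in D(L): A^*A,\ AA^*\in D(L)\}$. Let $T\neq 0$ be a positive finite rank operator in $D(L)$ and let $h$ be an associate vector for $T$: there are orthonormal vectors $k_1',\dots,k_m'$ and numbers $t_1',\dots,t_m'>0$ with $T=\sum_{s=1}^m t_s'|k_s'\rangle\langle k_s'|$ such that, with $t=\sum_s t_s'$ and $k_s=\sqrt t\,k_s'$, one has $h=\sum_{s=1}^m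 \|k_s\|^{-2}k_s$. Assume that $|Th\rangle\langle Th|\in D(L)$. Let $U$ be the linear subspace $U=\{x\in\mathcal{H}: |x\rangle\langle Th|\in\mathcal{A}\}$ and let $G:U\to\mathcal{H}$ be the linear operator $$G(u)=L(|u\rangle\langle Th|)h-\tfrac12\langle h,L(T)h\rangle u .$$ Then there is a linear map $\phi$ from $\mathcal{A}$ to the sesquilinear forms on $U\times U$ (conjugate linear in the first variable) which is $U$-completely positive, i.e. $\sum_{i,j=1}^k\phi(A_{ij})(u_i,u_j)\ge 0$ for all $k\in\mathbb{N}$, all $u_1,\dots,u_k\in U$ and all $k\times k$ matrices $(A_{ij})$ with entries in $\mathcal{A}$ that are positive as operators on $\mathcal{H}^k$, such that $$\langle u,L(A)v\rangle=\phi(A)(u,v)+\langle u,GAv\rangle+\langle GA^*u,v\rangle$$ for all $A\in\mathcal{A}$ and $u,v\in U$ (here $Av, A^*u\in U$). -/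

import Mathlib

open Filter Topology
open scoped NNReal InnerProductSpace ComplexOrder CStarAlgebra

noncomputable section

namespace QMS

variable {H : Type*} [NormedAddCommGroup H] [InnerProductSpace ℂ H] [CompleteSpace H]

/-- A sequence of vectors whose norms are square summable. -/
def SqSummable (x : ℕ → H) : Prop := Summable fun n => ‖x n‖ ^ 2

/-- The functional `A ↦ ∑ₙ ⟪xₙ, A yₙ⟫`. For square summable `x`, `y` this is `A ↦ tr (A S)` with
`S = ∑ₙ |yₙ⟩⟨xₙ|`, and every trace class operator `S` has this form. -/
def traceFunctional (x y : ℕ → H) (A : H →L[ℂ] H) : ℂ := ∑' n, ⟪x n, A (y n)⟫_ℂ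

variable (H) in
/-- The `σ`-weak topology on the bounded operators on `H`: the coarsest topology that makes all the
functionals `A ↦ ∑ₙ ⟪xₙ, A yₙ⟫` with `∑ₙ ‖xₙ‖² < ∞` and `∑ₙ ‖yₙ‖² < ∞` continuous. -/
@[reducible] def sigmaWeak : TopologicalSpace (H →L[ℂ] H) :=
  ⨅ (x : ℕ → H) (y : ℕ → H) (_ : SqSummable x) (_ : SqSummable y),
    TopologicalSpace.induced (traceFunctional x y) inferInstance

/-- Convergence in the `σ`-weak topology. -/
def SigmaWeakTendsto {α : Type*} (f : α → H →L[ℂ] H) (l : Filter α) (B : H →L[ℂ] H) : Prop :=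
  Tendsto f l (@nhds _ (sigmaWeak H) B)

theorem summable_traceFunctional {x y : ℕ → H} (hx : SqSummable x) (hy : SqSummable y)
    (A : H →L[ℂ] H) : Summable fun n => ⟪x n, A (y n)⟫_ℂ := by
  refine Summable.of_norm_bounded (g := fun n => ‖A‖ * (‖x n‖ ^ 2 + ‖y n‖ ^ 2))
    ((hx.add hy).mul_left _) fun n => ?_
  have h1 := norm_inner_le_norm (𝕜 := ℂ) (x n) (A (y n))
  have h2 := mul_le_mul_of_nonneg_left (A.le_opNorm (y n)) (norm_nonneg (x n))
  nlinarith [mul_nonneg (norm_nonneg A) (sq_nonneg (‖x n‖ - ‖y n‖)),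
    mul_nonneg (norm_nonneg A) (sq_nonneg (‖x n‖)), mul_nonneg (norm_nonneg A) (sq_nonneg (‖y n‖))]

theorem traceFunctional_add {x y : ℕ → H} (hx : SqSummable x) (hy : SqSummable y)
    (A B : H →L[ℂ] H) :
    traceFunctional x y (A + B) = traceFunctional x y A + traceFunctional x y B := by
  simp only [traceFunctional, add_apply, inner_add_right]
  exact (summable_traceFunctional hx hy A).tsum_add (summable_traceFunctional hx hy B)

theorem traceFunctional_smul (x y : ℕ → H) (c : ℂ) (A : H →L[ℂ] H) :
    traceFunctional x y (c • A) = c * traceFunctional x y A := by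
  simp only [traceFunctional, smul_apply, inner_smul_right]
  exact tsum_mul_left

theorem sigmaWeakTendsto_iff {α : Type*} {f : α → H →L[ℂ] H} {l : Filter α} {B : H →L[ℂ] H} :
    SigmaWeakTendsto f l B ↔ ∀ x y : ℕ → H, SqSummable x → SqSummable y →
      Tendsto (fun a => traceFunctional x y (f a)) l (𝓝 (traceFunctional x y B)) := by
  unfold SigmaWeakTendsto sigmaWeak
  rw [nhds_iInf]
  simp only [tendsto_iInf]
  refine forall_congr' fun x => ?_
  rw [nhds_iInf]
  simp only [tendsto_iInf]
  refine forall_congr' fun y => ?_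
  rw [nhds_iInf]
  simp only [tendsto_iInf]
  refine forall_congr' fun hx => ?_
  rw [nhds_iInf]
  simp only [tendsto_iInf]
  refine forall_congr' fun hy => ?_
  rw [nhds_induced, tendsto_comap_iff]
  rfl

theorem SigmaWeakTendsto.add {α : Type*} {f g : α → H →L[ℂ] H} {l : Filter α} {B C : H →L[ℂ] H}
    (hf : SigmaWeakTendsto f l B) (hg : SigmaWeakTendsto g l C) :
    SigmaWeakTendsto (fun a => f a + g a) l (B + C) := by
  rw [sigmaWeakTendsto_iff] at *
  intro x y hx hy
  simpa only [traceFunctional_add hx hy] using (hf x y hx hy).add (hg x y hx hy)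

theorem SigmaWeakTendsto.smul {α : Type*} {f : α → H →L[ℂ] H} {l : Filter α} {B : H →L[ℂ] H}
    (c : ℂ) (hf : SigmaWeakTendsto f l B) : SigmaWeakTendsto (fun a => c • f a) l (c • B) := by
  rw [sigmaWeakTendsto_iff] at *
  intro x y hx hy
  simpa only [traceFunctional_smul] using (hf x y hx hy).const_mul c

theorem SigmaWeakTendsto.unique {α : Type*} {f : α → H →L[ℂ] H} {l : Filter α} [l.NeBot]
    {B C : H →L[ℂ] H} (hB : SigmaWeakTendsto f l B) (hC : SigmaWeakTendsto f l C) : B = C := by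
  rw [sigmaWeakTendsto_iff] at hB hC
  have hs : ∀ v : H, SqSummable (Pi.single 0 v : ℕ → H) := fun v =>
    summable_of_ne_finset_zero (s := {0}) fun n hn => by
      simp [Pi.single_eq_of_ne (Finset.notMem_singleton.mp hn)]
  have hsingle : ∀ (u v : H) (D : H →L[ℂ] H),
      traceFunctional (Pi.single 0 u : ℕ → H) (Pi.single 0 v) D = ⟪u, D v⟫_ℂ := fun u v D => by
    rw [traceFunctional, tsum_eq_single 0 fun n hn => by simp [Pi.single_eq_of_ne hn]]
    simp
  refine ContinuousLinearMap.ext fun v => ext_inner_left ℂ fun u => ?_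
  rw [← hsingle, ← hsingle]
  exact tendsto_nhds_unique (hB _ _ (hs u) (hs v)) (hC _ _ (hs u) (hs v))

variable (H) in
/-- A quantum Markov semigroup on the bounded operators on `H`: a one-parameter semigroup of
`σ`-weakly continuous, completely positive, unital linear maps with `σ`-weakly continuous
orbits. -/
structure QuantumMarkovSemigroup where
  /-- The maps `T_t`, for `t ≥ 0`. -/
  map : ℝ≥0 → ((H →L[ℂ] H) →CP (H →L[ℂ] H))
  sigmaWeak_continuous : ∀ t, Continuous[sigmaWeak H, sigmaWeak H] (map t)
  map_zero : ∀ A, map 0 A = A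
  map_add : ∀ t s A, map (t + s) A = map t (map s A)
  sigmaWeak_continuous_orbit : ∀ A, Continuous[inferInstance, sigmaWeak H] fun t => map t A
  map_one : ∀ t, map t 1 = 1

namespace QuantumMarkovSemigroup

variable (S : QuantumMarkovSemigroup H)

/-- `B` is the `σ`-weak limit of `(T_t A - A) / t` as `t → 0`, `t > 0`. -/
def HasGenerator (A B : H →L[ℂ] H) : Prop :=
  SigmaWeakTendsto (fun t : ℝ≥0 => ((t : ℝ) : ℂ)⁻¹ • (S.map t A - A)) (𝓝[>] 0) B

theorem HasGenerator.add {A A' B B' : H →L[ℂ] H} (h : S.HasGenerator A B)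
    (h' : S.HasGenerator A' B') : S.HasGenerator (A + A') (B + B') := by
  have := SigmaWeakTendsto.add h h'
  refine this.congr fun t => ?_
  rw [_root_.map_add, ← smul_add]
  congr 1
  abel

theorem HasGenerator.smul {A B : H →L[ℂ] H} (c : ℂ) (h : S.HasGenerator A B) :
    S.HasGenerator (c • A) (c • B) := by
  have := SigmaWeakTendsto.smul c h
  refine this.congr fun t => ?_
  rw [_root_.map_smul, ← smul_sub, smul_comm]

/-- The infinitesimal generator `L`, an unbounded operator with domain `D(L)`: `A ∈ D(L)` iff
`(T_t A - A) / t` converges `σ`-weakly as `t → 0`, and `L(A)` is the limit. -/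
def generator : (H →L[ℂ] H) →ₗ.[ℂ] (H →L[ℂ] H) where
  domain :=
    { carrier := {A | ∃ B, S.HasGenerator A B}
      add_mem' := fun ⟨B, hB⟩ ⟨C, hC⟩ => ⟨B + C, hB.add S hC⟩
      zero_mem' := ⟨0, sigmaWeakTendsto_iff.mpr fun x y _ _ => by
        simp [traceFunctional]⟩
      smul_mem' := fun c _ ⟨B, hB⟩ => ⟨c • B, hB.smul S c⟩ }
  toFun :=
    { toFun := fun A => Classical.choose A.2
      map_add' := fun A A' => (Classical.choose_spec (A + A').2).unique
        ((Classical.choose_spec A.2).add S (Classical.choose_spec A'.2))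
      map_smul' := fun c A => (Classical.choose_spec (c • A).2).unique
        ((Classical.choose_spec A.2).smul S c) }

theorem generator_spec (A : S.generator.domain) : S.HasGenerator A (S.generator A) :=
  Classical.choose_spec A.2

/-- The `*`-subalgebras of the bounded operators (closed or not, with unit or not) that are contained
in `D(L)`. -/
def starSubalgebrasInDomain : Set (NonUnitalStarSubalgebra ℂ (H →L[ℂ] H)) :=
  {B | ∀ A ∈ B, A ∈ S.generator.domain}

/-- The domain algebra of `L`, the largest `*`-subalgebra of `D(L)`, as the supremum of all
`*`-subalgebras contained in `D(L)`. -/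
def domainAlgebra : NonUnitalStarSubalgebra ℂ (H →L[ℂ] H) :=
  sSup S.starSubalgebrasInDomain

/-- The subspace of all `x` such that `|x⟩⟨w|` lies in the domain algebra. -/
def rankOneSubspace (w : H) : Submodule ℂ H where
  carrier := {x | InnerProductSpace.rankOne ℂ x w ∈ S.domainAlgebra}
  add_mem' {x y} hx hy := by
    simpa only [Set.mem_ofPred_eq, _root_.map_add, add_apply] using
      add_mem (show InnerProductSpace.rankOne ℂ x w ∈ S.domainAlgebra from hx)
        (show InnerProductSpace.rankOne ℂ y w ∈ S.domainAlgebra from hy)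
  zero_mem' := by
    simpa only [Set.mem_ofPred_eq, _root_.map_zero, zero_apply] using
      zero_mem S.domainAlgebra
  smul_mem' c x hx := by
    simpa only [Set.mem_ofPred_eq, _root_.map_smul, smul_apply] using
      SMulMemClass.smul_mem c (show InnerProductSpace.rankOne ℂ x w ∈ S.domainAlgebra from hx)

/-- The domain algebra leaves the subspace `{x | |x⟩⟨w| ∈ domain algebra}` invariant. -/
theorem apply_mem_rankOneSubspace {w : H} {A : H →L[ℂ] H} (hA : A ∈ S.domainAlgebra) {x : H}
    (hx : x ∈ S.rankOneSubspace w) : A x ∈ S.rankOneSubspace w := by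
  have h : A * InnerProductSpace.rankOne ℂ x w = InnerProductSpace.rankOne ℂ (A x) w := by
    ext v
    simp [InnerProductSpace.rankOne_apply]
  have h' : A * InnerProductSpace.rankOne ℂ x w ∈ S.domainAlgebra := mul_mem hA hx
  rw [h] at h'
  exact h'

/-- The domain algebra acting on the subspace `{x | |x⟩⟨w| ∈ domain algebra}`. -/
def act {w : H} (A : S.domainAlgebra) (x : S.rankOneSubspace w) : S.rankOneSubspace w :=
  ⟨(A : H →L[ℂ] H) x, S.apply_mem_rankOneSubspace A.2 x.2⟩

end QuantumMarkovSemigroup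

/-- `h` is an associate vector for `T`: there are a spectral decomposition
`T = ∑ₛ t'ₛ |k'ₛ⟩⟨k'ₛ|` with finitely many orthonormal vectors `k'ₛ` and numbers `t'ₛ > 0` such that,
with `t = ∑ₛ t'ₛ` and `kₛ = √t k'ₛ`, one has `h = ∑ₛ ‖kₛ‖⁻² kₛ`. -/
def IsAssociateVector (T : H →L[ℂ] H) (h : H) : Prop :=
  ∃ (m : ℕ) (k' : Fin m → H) (t' : Fin m → ℝ) (k : Fin m → H),
    Orthonormal ℂ k' ∧ (∀ s, 0 < t' s) ∧
    T = ∑ s, (t' s : ℂ) • InnerProductSpace.rankOne ℂ (k' s) (k' s) ∧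
    (∀ s, k s = (√(∑ r, t' r) : ℂ) • k' s) ∧
    h = ∑ s, ((‖k s‖ ^ 2)⁻¹ : ℂ) • k s

/-- `U`-complete positivity of a linear map from a space `V` of bounded operators on `H` to the
sesquilinear forms on `U × U` (conjugate linear in the first variable). -/
def IsUCompletelyPositive {V : Type*} [SetLike V (H →L[ℂ] H)] [AddSubmonoidClass V (H →L[ℂ] H)]
    [SMulMemClass V ℂ (H →L[ℂ] H)] (𝒜 : V) (U : Submodule ℂ H)
    (φ : 𝒜 →ₗ[ℂ] (U →ₗ⋆[ℂ] U →ₗ[ℂ] ℂ)) : Prop :=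
  ∀ (k : ℕ) (A : Fin k → Fin k → 𝒜),
    0 ≤ CStarMatrix.ofMatrix (Matrix.of fun i j => (A i j : H →L[ℂ] H)) →
    ∀ u : Fin k → U, 0 ≤ ∑ i, ∑ j, φ (A i j) (u i) (u j)

end QMS

end

/-!
An operator `A` lies in the domain of the generator iff `‖T_t A - A‖ = O(t)`: bounded difference
quotients have a `σ`-weak cluster point, and a cluster point is the limit because `t ↦ T_t A` then
has a `σ`-weakly continuous Dini derivative. For `A` in the domain, `A* A` lies in the domain iff
the Schwarz defect `T_t(A* A) - T_t(A)* T_t(A)` is `O(t)`. The defect of a sum or a product is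
bounded by those of its terms or factors, so the operators `A` with `A`, `A* A`, `A A*` in the
domain form a `*`-algebra.

Put `w = T h`, so that `⟪w, h⟫ = 1`. Complete positivity of `T_t` on the matrix with blocks
`A_ij`, `|A_ij u_j⟩⟨w|`, `|w⟩⟨A_ij* u_i|` and `⟪u_i, A_ij u_j⟫ |w⟩⟨w|`, tested on the vector with
entries `u_i` and `-h`, gives an expression that vanishes at `t = 0`; its derivative there is
therefore nonnegative. The last block contributes `⟪h, L(|w⟩⟨w|) h⟫`, and this is at most
`⟪h, L(T) h⟫` because `|w⟩⟨w| ≤ T` with equality in the direction `h`.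
-/

noncomputable section

namespace QMS

theorem mapClusterPt_sub_of_tendsto {α E : Type*} [TopologicalSpace E] [AddGroup E]
    [IsTopologicalAddGroup E] {l : Filter α} {u v : α → E} {x y : E} (hu : MapClusterPt x l u)
    (hv : Tendsto v l (𝓝 y)) : MapClusterPt (x - y) l (fun a => u a - v a) := by
  obtain ⟨U, hU, hux⟩ := mapClusterPt_iff_ultrafilter.mp hu
  exact mapClusterPt_iff_ultrafilter.mpr ⟨U, hU, hux.sub (hv.mono_left hU)⟩

section DiniDerivative

variable {E : Type*} [NormedAddCommGroup E] [NormedSpace ℝ E] {f g : ℝ → E} {a b : ℝ}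

theorem slope_norm_le_norm_slope {x y : ℝ} (hxy : x < y) :
    slope (fun z => ‖f z‖) x y ≤ ‖slope f x y‖ := by
  rw [slope_def_field, slope_def_module, norm_smul, norm_inv, Real.norm_of_nonneg (by linarith),
    div_eq_inv_mul]
  exact mul_le_mul_of_nonneg_left (norm_sub_norm_le _ _) (inv_nonneg.mpr (by linarith))

theorem eq_of_mapClusterPt_slope_zero (hab : a ≤ b) (hf : ContinuousOn f (Set.Icc a b))
    (h : ∀ x ∈ Set.Ico a b, MapClusterPt 0 (𝓝[>] x) (slope f x)) : f b = f a := by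
  have hslope : ∀ x ∈ Set.Ico a b, ∀ r, 0 < r →
      ∃ᶠ z in 𝓝[>] x, slope (fun z => ‖f z - f a‖) x z < r := fun x hx r hr => by
    have hsmall : ∃ᶠ z in 𝓝[>] x, ‖slope f x z‖ < r :=
      (h x hx).frequently
        ((continuous_norm (E := E)).continuousAt.eventually_lt_const (by simpa using hr))
    refine (hsmall.and_eventually self_mem_nhdsWithin).mono fun z ⟨hz, hxz⟩ => ?_
    refine (slope_norm_le_norm_slope hxz).trans_lt ?_
    rwa [slope_def_module, sub_sub_sub_cancel_right, ← slope_def_module]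
  have := image_le_of_liminf_slope_right_le_deriv_boundary (f := fun z => ‖f z - f a‖)
    (B := fun _ => 0) (B' := fun _ => 0) (hf.sub continuousOn_const).norm (by simp)
    continuousOn_const (fun x _ => hasDerivWithinAt_const x _ 0) hslope (Set.right_mem_Icc.mpr hab)
  exact sub_eq_zero.mp (norm_le_zero_iff.mp this)

variable [CompleteSpace E]

theorem sub_eq_integral_of_mapClusterPt_slope (hf : Continuous f) (hg : Continuous g) (hab : a ≤ b)
    (h : ∀ x ∈ Set.Ico a b, MapClusterPt (g x) (𝓝[>] x) (slope f x)) :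
    f b - f a = ∫ x in a..b, g x := by
  have hG : ∀ x, HasDerivAt (fun x => ∫ r in a..x, g r) (g x) x := fun x =>
    (hg.integral_hasStrictDerivAt a x).hasDerivAt
  have hF : Continuous fun x => f x - ∫ r in a..x, g r :=
    hf.sub (continuous_iff_continuousAt.mpr fun x => (hG x).continuousAt)
  have := eq_of_mapClusterPt_slope_zero hab hF.continuousOn fun x hx => by
    have hGx : Tendsto (slope (fun x => ∫ r in a..x, g r) x) (𝓝[>] x) (𝓝 (g x)) :=
      (hasDerivWithinAt_iff_tendsto_slope' (lt_irrefl x)).mp (hG x).hasDerivWithinAt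
    convert mapClusterPt_sub_of_tendsto (h x hx) hGx using 1
    · rw [sub_self]
    · funext z
      simp only [slope_def_module, ← smul_sub]
      congr 1
      abel
  rw [intervalIntegral.integral_same, sub_zero] at this
  rw [← this]; abel

theorem hasDerivWithinAt_of_mapClusterPt_slope (hf : Continuous f) (hg : Continuous g)
    (h : ∀ x, a ≤ x → MapClusterPt (g x) (𝓝[>] x) (slope f x)) :
    HasDerivWithinAt f (g a) (Set.Ici a) a := by
  have hG : HasDerivAt (fun x => ∫ r in a..x, g r) (g a) a :=
    (hg.integral_hasStrictDerivAt a a).hasDerivAt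
  refine (hG.hasDerivWithinAt.const_add (f a)).congr (fun x hx => ?_) (by simp)
  rw [← sub_eq_integral_of_mapClusterPt_slope hf hg hx fun y hy => h y hy.1]
  abel

end DiniDerivative

section Inner

variable {𝕜 H : Type*} [RCLike 𝕜] [NormedAddCommGroup H] [InnerProductSpace 𝕜 H]

theorem norm_inner_apply_le {C : ℝ} {A : H →L[𝕜] H} (hA : ‖A‖ ≤ C) (u v : H) :
    ‖inner 𝕜 u (A v)‖ ≤ C * (‖u‖ ^ 2 + ‖v‖ ^ 2) :=
  calc ‖inner 𝕜 u (A v)‖ ≤ ‖u‖ * ‖A v‖ := norm_inner_le_norm _ _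
    _ ≤ ‖u‖ * (C * ‖v‖) := by gcongr; exact A.le_of_opNorm_le hA v
    _ = C * (‖u‖ * ‖v‖) := by ring
    _ ≤ C * (‖u‖ ^ 2 + ‖v‖ ^ 2) := by
      gcongr
      · exact (norm_nonneg A).trans hA
      · nlinarith [sq_nonneg (‖u‖ - ‖v‖), sq_nonneg (‖u‖), sq_nonneg (‖v‖)]

variable [CompleteSpace H]

theorem exists_norm_le_of_norm_inner_le {ι : Type*} {f : ι → H →L[𝕜] H}
    (h : ∀ u v, ∃ C, ∀ i, ‖inner 𝕜 u (f i v)‖ ≤ C) : ∃ C, ∀ i, ‖f i‖ ≤ C := by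
  refine banach_steinhaus fun v => ?_
  obtain ⟨C, hC⟩ := banach_steinhaus (g := fun i => innerSL 𝕜 (f i v)) fun u =>
    (h u v).imp fun C hC i => by simpa [norm_inner_symm] using hC i
  exact ⟨C, fun i => by simpa using hC i⟩

theorem isBigO_one_of_tendsto_inner {α : Type*} {l : Filter α} [l.IsCountablyGenerated]
    {f : α → H →L[𝕜] H} {B : H →L[𝕜] H}
    (h : ∀ u v, Tendsto (fun a => inner 𝕜 u (f a v)) l (𝓝 (inner 𝕜 u (B v)))) :
    f =O[l] fun _ => (1 : ℝ) := by
  obtain ⟨s, hs⟩ := l.exists_antitone_basis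
  by_contra hf
  have hlarge : ∀ n : ℕ, ∃ a ∈ s n, n < ‖f a‖ := fun n => by
    by_contra! hn
    exact hf (.of_bound n (mem_of_superset (hs.mem n) fun a ha => by simpa using hn a ha))
  choose a has ha using hlarge
  obtain ⟨C, hC⟩ := exists_norm_le_of_norm_inner_le (f := fun n => f (a n)) fun u v => by
    obtain ⟨C, hC⟩ := (Metric.isBounded_range_of_tendsto _
      ((h u v).comp (hs.tendsto has))).exists_norm_le
    exact ⟨C, fun n => hC _ ⟨n, rfl⟩⟩
  obtain ⟨n, hn⟩ := exists_nat_gt C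
  exact ((ha n).trans_le (hC n)).not_gt hn

theorem exists_tendsto_of_isBigO_one {α E : Type*} [NormedAddCommGroup E] [ProperSpace E]
    {U : Ultrafilter α} {f : α → E} (hf : f =O[(U : Filter α)] fun _ => (1 : ℝ)) :
    ∃ x, Tendsto f U (𝓝 x) := by
  obtain ⟨C, hC⟩ := (Asymptotics.isBigO_one_iff ℝ).mp hf
  obtain ⟨x, -, hx⟩ := (isCompact_closedBall (0 : E) C).ultrafilter_le_nhds (U.map f)
    (by
      rw [le_principal_iff, Ultrafilter.mem_coe, Ultrafilter.mem_map]
      filter_upwards [eventually_map.mp hC] with a ha using by simpa using ha)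
  exact ⟨x, hx⟩

theorem exists_inner_eq_of_tendsto_inner {α : Type*} {l : Filter α} [l.NeBot] {f : α → H →L[𝕜] H}
    (hf : f =O[l] fun _ => (1 : ℝ)) {β : H → H → 𝕜}
    (hβ : ∀ u v, Tendsto (fun a => inner 𝕜 (f a u) v) l (𝓝 (β u v))) :
    ∃ B : H →L[𝕜] H, ∀ u v, inner 𝕜 (B u) v = β u v := by
  obtain ⟨C, hC⟩ := (Asymptotics.isBigO_one_iff ℝ).mp hf
  let form : H →ₗ⋆[𝕜] H →ₗ[𝕜] 𝕜 := LinearMap.mk₂'ₛₗ _ _ β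
    (fun u u' v => tendsto_nhds_unique (hβ _ _)
      (((hβ u v).add (hβ u' v)).congr fun a => by simp [inner_add_left]))
    (fun c u v => tendsto_nhds_unique (hβ _ _)
      (((hβ u v).const_mul _).congr fun a => by simp [inner_smul_left]))
    (fun u v v' => tendsto_nhds_unique (hβ _ _)
      (((hβ u v).add (hβ u v')).congr fun a => by simp [inner_add_right]))
    (fun c u v => tendsto_nhds_unique (hβ _ _)
      (((hβ u v).const_mul _).congr fun a => by simp [inner_smul_right]))
  have hbound : ∀ u v, ‖form u v‖ ≤ C * ‖u‖ * ‖v‖ := fun u v =>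
    le_of_tendsto (hβ u v).norm <| (eventually_map.mp hC).mono fun a ha =>
      (norm_inner_le_norm _ _).trans
        (mul_le_mul_of_nonneg_right ((f a).le_of_opNorm_le ha u) (norm_nonneg v))
  exact ⟨InnerProductSpace.continuousLinearMapOfBilin (form.mkContinuous₂ C hbound), fun u v =>
    InnerProductSpace.continuousLinearMapOfBilin_apply _ u v⟩

end Inner

section SigmaWeak

theorem sqSummable_single {E : Type*} [NormedAddCommGroup E] (v : E) :
    SqSummable (Pi.single 0 v : ℕ → E) :=
  summable_of_ne_finset_zero (s := {0}) fun n hn => by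
    simp [Pi.single_eq_of_ne (Finset.notMem_singleton.mp hn)]

variable {H : Type*} [NormedAddCommGroup H] [InnerProductSpace ℂ H]

theorem traceFunctional_single (u v : H) (A : H →L[ℂ] H) :
    traceFunctional (Pi.single 0 u : ℕ → H) (Pi.single 0 v) A = ⟪u, A v⟫_ℂ := by
  rw [traceFunctional, tsum_eq_single 0 fun n hn => by simp [Pi.single_eq_of_ne hn]]
  simp

variable [CompleteSpace H] {x y : ℕ → H} {α : Type*} {l : Filter α} {f : α → H →L[ℂ] H}
  {B : H →L[ℂ] H}

theorem traceFunctional_sub (hx : SqSummable x) (hy : SqSummable y) (A B : H →L[ℂ] H) :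
    traceFunctional x y (A - B) = traceFunctional x y A - traceFunctional x y B := by
  rw [eq_sub_iff_add_eq, ← traceFunctional_add hx hy, sub_add_cancel]

theorem traceFunctional_star (x y : ℕ → H) (A : H →L[ℂ] H) :
    traceFunctional x y (star A) = starRingEnd ℂ (traceFunctional y x A) := by
  simp only [traceFunctional, Complex.conj_tsum, inner_conj_symm,
    ContinuousLinearMap.star_eq_adjoint, ContinuousLinearMap.adjoint_inner_right]

theorem SigmaWeakTendsto.star (hf : SigmaWeakTendsto f l B) :
    SigmaWeakTendsto (fun a => star (f a)) l (star B) :=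
  sigmaWeakTendsto_iff.mpr fun x y hx hy => by
    simpa only [traceFunctional_star, Function.comp_def] using
      (Complex.continuous_conj.tendsto _).comp (sigmaWeakTendsto_iff.mp hf y x hy hx)

theorem SigmaWeakTendsto.inner (hf : SigmaWeakTendsto f l B) (u v : H) :
    Tendsto (fun a => ⟪u, f a v⟫_ℂ) l (𝓝 ⟪u, B v⟫_ℂ) := by
  simpa only [traceFunctional_single] using
    sigmaWeakTendsto_iff.mp hf _ _ (sqSummable_single u) (sqSummable_single v)

theorem SigmaWeakTendsto.isBigO_one [l.IsCountablyGenerated] (hf : SigmaWeakTendsto f l B) :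
    f =O[l] fun _ => (1 : ℝ) :=
  isBigO_one_of_tendsto_inner hf.inner

theorem sigmaWeakTendsto_of_tendsto_inner (hf : f =O[l] fun _ => (1 : ℝ))
    (h : ∀ u v, Tendsto (fun a => ⟪u, f a v⟫_ℂ) l (𝓝 ⟪u, B v⟫_ℂ)) : SigmaWeakTendsto f l B := by
  obtain ⟨C, hC⟩ := (Asymptotics.isBigO_one_iff ℝ).mp hf
  exact sigmaWeakTendsto_iff.mpr fun x y hx hy =>
    tendsto_tsum_of_dominated_convergence ((hx.add hy).mul_left C) (fun n => h (x n) (y n))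
      ((eventually_map.mp hC).mono fun a ha n => norm_inner_apply_le ha (x n) (y n))

theorem exists_sigmaWeakTendsto_of_isBigO_one {U : Ultrafilter α}
    (hf : f =O[(U : Filter α)] fun _ => (1 : ℝ)) : ∃ B, SigmaWeakTendsto f U B := by
  have hlim : ∀ u v, ∃ c : ℂ, Tendsto (fun a => ⟪f a u, v⟫_ℂ) U (𝓝 c) := fun u v => by
    refine exists_tendsto_of_isBigO_one (.trans (.of_bound (‖u‖ * ‖v‖) ?_) hf)
    filter_upwards with a
    calc ‖⟪f a u, v⟫_ℂ‖ ≤ ‖f a u‖ * ‖v‖ := norm_inner_le_norm _ _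
      _ ≤ ‖f a‖ * ‖u‖ * ‖v‖ := by gcongr; exact (f a).le_opNorm u
      _ = ‖u‖ * ‖v‖ * ‖f a‖ := by ring
  choose β hβ using hlim
  obtain ⟨B, hB⟩ := exists_inner_eq_of_tendsto_inner hf hβ
  refine ⟨B, sigmaWeakTendsto_of_tendsto_inner hf fun u v => ?_⟩
  rw [← inner_conj_symm, hB]
  exact ((Complex.continuous_conj.tendsto _).comp (hβ v u)).congr fun a => inner_conj_symm _ _

end SigmaWeak

theorem tendsto_add_coe_nhdsGT (x : ℝ) : Tendsto (fun t : ℝ≥0 => x + t) (𝓝[>] 0) (𝓝[>] x) := by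
  refine tendsto_nhdsWithin_iff.mpr ⟨?_, ?_⟩
  · have hcont : Continuous fun t : ℝ≥0 => x + t := by fun_prop
    simpa using (hcont.tendsto 0).mono_left nhdsWithin_le_nhds
  · filter_upwards [self_mem_nhdsWithin] with t ht
    simpa using ht

theorem inv_coe_nonneg (t : ℝ≥0) : (0 : ℂ) ≤ ((t : ℝ) : ℂ)⁻¹ := by
  rw [← Complex.ofReal_inv]
  exact Complex.zero_le_real.mpr (inv_nonneg.mpr t.coe_nonneg)

theorem isBigO_inv_smul_iff {E : Type*} [NormedAddCommGroup E] [NormedSpace ℂ E] {f : ℝ≥0 → E} :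
    (fun t : ℝ≥0 => ((t : ℝ) : ℂ)⁻¹ • f t) =O[𝓝[>] 0] (fun _ => (1 : ℝ)) ↔
      f =O[𝓝[>] 0] NNReal.toReal := by
  simp only [Asymptotics.isBigO_iff]
  refine exists_congr fun C => eventually_congr ?_
  filter_upwards [self_mem_nhdsWithin] with t ht
  have ht0 : (0 : ℝ) < t := ht
  simp [norm_smul, inv_mul_le_iff₀ ht0, mul_comm]

namespace QuantumMarkovSemigroup

variable {H : Type*} [NormedAddCommGroup H] [InnerProductSpace ℂ H] [CompleteSpace H]
  (S : QuantumMarkovSemigroup H) {A B : H →L[ℂ] H} {x y : ℕ → H}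

theorem sigmaWeakTendsto_map {α : Type*} {f : α → H →L[ℂ] H} {l : Filter α}
    (hf : SigmaWeakTendsto f l B) (t : ℝ≥0) :
    SigmaWeakTendsto (fun a => S.map t (f a)) l (S.map t B) :=
  (@Continuous.tendsto _ _ (sigmaWeak H) (sigmaWeak H) _ (S.sigmaWeak_continuous t) B).comp hf

theorem continuous_traceFunctional_map (hx : SqSummable x) (hy : SqSummable y) (A : H →L[ℂ] H) :
    Continuous fun t => traceFunctional x y (S.map t A) := by
  refine continuous_iff_continuousAt.mpr fun t => ?_
  have horbit : SigmaWeakTendsto (fun t => S.map t A) (𝓝 t) (S.map t A) :=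
    @Continuous.tendsto _ _ _ (sigmaWeak H) _ (S.sigmaWeak_continuous_orbit A) t
  exact sigmaWeakTendsto_iff.mp horbit x y hx hy

theorem slope_traceFunctional_map (hx : SqSummable x) (hy : SqSummable y) (A : H →L[ℂ] H)
    (r t : ℝ≥0) :
    slope (fun r : ℝ => traceFunctional x y (S.map r.toNNReal A)) r (r + t) =
      traceFunctional x y (S.map r (((t : ℝ) : ℂ)⁻¹ • (S.map t A - A))) := by
  rw [_root_.map_smul, _root_.map_sub, ← S.map_add, traceFunctional_smul,
    traceFunctional_sub hx hy, slope_def_module, Real.toNNReal_coe, ← NNReal.coe_add,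
    Real.toNNReal_coe, NNReal.coe_add, add_sub_cancel_left, Complex.real_smul, Complex.ofReal_inv]

-- Semigroup and `σ`-weak continuity transport convergence of the difference quotients from `0` to
-- every `r ≥ 0`, so `r ↦ T_r B` is a Dini derivative of `r ↦ T_r A` on all of `[0, ∞)`.
theorem hasGenerator_of_sigmaWeakTendsto {l : Filter ℝ≥0} [l.NeBot] (hl : l ≤ 𝓝[>] 0)
    (h : SigmaWeakTendsto (fun t : ℝ≥0 => ((t : ℝ) : ℂ)⁻¹ • (S.map t A - A)) l B) :
    S.HasGenerator A B := by
  refine sigmaWeakTendsto_iff.mpr fun x y hx hy => ?_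
  have hcont : ∀ C : H →L[ℂ] H, Continuous fun r : ℝ => traceFunctional x y (S.map r.toNNReal C) :=
    fun C => (S.continuous_traceFunctional_map hx hy C).comp continuous_real_toNNReal
  have hderiv := hasDerivWithinAt_of_mapClusterPt_slope (a := 0) (hcont A) (hcont B) fun r hr => by
    lift r to ℝ≥0 using hr
    rw [Real.toNNReal_coe]
    have hr := sigmaWeakTendsto_iff.mp (S.sigmaWeakTendsto_map h r) x y hx hy
    refine .of_comp ((tendsto_add_coe_nhdsGT r).mono_left hl) (Tendsto.mapClusterPt ?_)
    exact hr.congr fun t => (S.slope_traceFunctional_map hx hy A r t).symm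
  have hslope := ((hasDerivWithinAt_iff_tendsto_slope' (lt_irrefl _)).mp
    hderiv.Ioi_of_Ici).comp (tendsto_add_coe_nhdsGT 0)
  rw [Real.toNNReal_zero, S.map_zero] at hslope
  refine hslope.congr fun t => ?_
  simpa [S.map_zero] using S.slope_traceFunctional_map hx hy A 0 t

theorem mem_domain_iff_isBigO : A ∈ S.generator.domain ↔
    (fun t : ℝ≥0 => S.map t A - A) =O[𝓝[>] 0] NNReal.toReal := by
  rw [← isBigO_inv_smul_iff]
  refine ⟨fun ⟨_, hB⟩ => SigmaWeakTendsto.isBigO_one hB, fun hA => ?_⟩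
  obtain ⟨B, hB⟩ := exists_sigmaWeakTendsto_of_isBigO_one
    (hA.mono (Ultrafilter.of_le (𝓝[>] (0 : ℝ≥0))))
  exact ⟨B, S.hasGenerator_of_sigmaWeakTendsto (Ultrafilter.of_le _) hB⟩

end QuantumMarkovSemigroup

section CompletelyPositive

-- Stated for an abstract algebra because the type class search required by
-- `CStarAlgebra.nonneg_iff_eq_star_mul_self` fails on `CStarMatrix ι ι A`.
theorem exists_eq_star_mul_self_of_nonneg {A : Type*} [NonUnitalCStarAlgebra A] [PartialOrder A]
    [StarOrderedRing A] {a : A} (ha : 0 ≤ a) : ∃ b, a = star b * b :=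
  CStarAlgebra.nonneg_iff_eq_star_mul_self.mp ha

variable {A B ι κ : Type*} [NonUnitalCStarAlgebra A] [PartialOrder A] [StarOrderedRing A]
  [NonUnitalCStarAlgebra B] [PartialOrder B] [StarOrderedRing B] [Fintype ι] [Fintype κ]

theorem exists_gram_of_nonneg {M : CStarMatrix ι ι A} (hM : 0 ≤ M) :
    ∃ N : ι → ι → A, ∀ i j, M i j = ∑ l, star (N l i) * N l j := by
  obtain ⟨N, rfl⟩ := exists_eq_star_mul_self_of_nonneg hM
  exact ⟨N, fun i j => by simp only [CStarMatrix.mul_apply, CStarMatrix.star_apply]⟩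

theorem gram_nonneg (N : κ → ι → A) :
    0 ≤ CStarMatrix.ofMatrix (Matrix.of fun i j => ∑ l, star (N l i) * N l j) := by
  classical
  cases isEmpty_or_nonempty ι with
  | inl _ => exact le_of_eq (CStarMatrix.ext isEmptyElim)
  | inr hι =>
    -- Each summand is `star R * R` for the matrix `R` whose only nonzero row is `N l`.
    let row (l : κ) : CStarMatrix ι ι A :=
      CStarMatrix.ofMatrix (Matrix.of fun i j => if i = hι.some then N l j else 0)
    refine (Finset.sum_nonneg (s := .univ) fun l _ => star_mul_self_nonneg (row l)).trans_eq ?_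
    ext i j
    refine (Matrix.sum_apply i j _ fun l => star (row l) * row l).trans ?_
    simp [row, CStarMatrix.mul_apply, CStarMatrix.star_apply, apply_ite star, ite_mul]

theorem star_mul_submatrix_mul_nonneg {M : CStarMatrix ι ι A} (hM : 0 ≤ M) (f : κ → ι) (X : κ → A) :
    0 ≤ CStarMatrix.ofMatrix (Matrix.of fun i j => star (X i) * M (f i) (f j) * X j) := by
  obtain ⟨N, hN⟩ := exists_gram_of_nonneg hM
  convert gram_nonneg fun l i => N l (f i) * X i using 5 with i j
  rw [hN, Finset.mul_sum, Finset.sum_mul]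
  simp only [star_mul, mul_assoc]

theorem sum_star_mul_mul_nonneg {M : CStarMatrix ι ι A} (hM : 0 ≤ M) (R : ι → A) :
    0 ≤ ∑ i, ∑ j, star (R i) * M i j * R j := by
  obtain ⟨N, hN⟩ := exists_gram_of_nonneg hM
  have hsq : ∑ i, ∑ j, star (R i) * M i j * R j
      = ∑ l, star (∑ i, N l i * R i) * ∑ j, N l j * R j := by
    simp only [hN, star_sum, star_mul, Finset.sum_mul, Finset.mul_sum, mul_assoc]
    rw [Finset.sum_comm_cycle]
    exact Finset.sum_congr rfl fun l _ => Finset.sum_comm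
  rw [hsq]
  exact Finset.sum_nonneg fun l _ => star_mul_self_nonneg _

theorem sum_star_mul_map_mul_nonneg (Φ : A →CP B) (X : ι → A) (R : ι → B) :
    0 ≤ ∑ i, ∑ j, star (R i) * Φ (star (X i) * X j) * R j := by
  simpa using sum_star_mul_mul_nonneg (Φ.map_cstarMatrix_nonneg _ (gram_nonneg fun _ : Unit => X)) R

theorem sum_inner_apply_nonneg {H : Type*} [NormedAddCommGroup H] [InnerProductSpace ℂ H]
    [CompleteSpace H] {M : CStarMatrix ι ι (H →L[ℂ] H)} (hM : 0 ≤ M) (ξ : ι → H) :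
    0 ≤ ∑ i, ∑ j, ⟪ξ i, M i j (ξ j)⟫_ℂ := by
  obtain ⟨N, hN⟩ := exists_gram_of_nonneg hM
  have hsq : ∑ i, ∑ j, ⟪ξ i, M i j (ξ j)⟫_ℂ = ∑ l, ⟪∑ i, N l i (ξ i), ∑ j, N l j (ξ j)⟫_ℂ := by
    simp only [hN, sum_inner, inner_sum, sum_apply, mul_apply_eq_comp,
      ContinuousLinearMap.star_eq_adjoint, ContinuousLinearMap.adjoint_inner_right]
    rw [Finset.sum_comm_cycle]
    exact Finset.sum_congr rfl fun l _ => Finset.sum_comm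
  rw [hsq]
  exact Finset.sum_nonneg fun l _ => by rw [inner_self_eq_norm_sq_to_K]; positivity

end CompletelyPositive

/-- The defect `Φ(X* X) - Φ(X)* Φ(X)` in the Schwarz inequality for `Φ`. For unital `Φ` with
Stinespring dilation `Φ = V* π V` it is `|π(X) V - V Φ(X)|²`. -/
def schwarzDefect {A B : Type*} [NonUnitalCStarAlgebra A] [PartialOrder A] [StarOrderedRing A]
    [NonUnitalCStarAlgebra B] [PartialOrder B] [StarOrderedRing B] (Φ : A →CP B) (X : A) : B :=
  Φ (star X * X) - star (Φ X) * Φ X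

section SchwarzDefect

variable {A B : Type*} [CStarAlgebra A] [PartialOrder A] [StarOrderedRing A]
  [CStarAlgebra B] [PartialOrder B] [StarOrderedRing B] (Φ : A →CP B)

theorem sum_star_mul_map_mul_le {ι : Type*} [Fintype ι] (a : A) (X : ι → A) (R : ι → B) :
    ∑ i, ∑ j, star (R i) * Φ (star (a * X i) * (a * X j)) * R j ≤
      ((‖a‖ ^ 2 : ℝ) : ℂ) • ∑ i, ∑ j, star (R i) * Φ (star (X i) * X j) * R j := by
  have hle : star a * a ≤ ((‖a‖ ^ 2 : ℝ) : ℂ) • (1 : A) := by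
    simpa only [Algebra.algebraMap_eq_smul_one, Complex.coe_smul] using
      CStarAlgebra.star_mul_le_algebraMap_norm_sq (a := a)
  obtain ⟨c, hc⟩ := exists_eq_star_mul_self_of_nonneg (sub_nonneg.mpr hle)
  have hcX (i j : ι) : star (c * X i) * (c * X j) =
      ((‖a‖ ^ 2 : ℝ) : ℂ) • (star (X i) * X j) - star (a * X i) * (a * X j) := by
    calc star (c * X i) * (c * X j) = star (X i) * (star c * c) * X j := by
          simp only [star_mul, mul_assoc]
      _ = _ := by
          simp only [← hc, star_mul, mul_sub, sub_mul, mul_smul_comm, smul_mul_assoc, mul_one,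
            mul_assoc]
  have hpos := sum_star_mul_map_mul_nonneg Φ (fun i => c * X i) R
  simpa only [hcX, map_sub, map_smul, mul_sub, sub_mul, mul_smul_comm, smul_mul_assoc,
    Finset.sum_sub_distrib, ← Finset.smul_sum, sub_nonneg] using hpos

variable {Φ}

theorem schwarzDefect_eq_sum (h1 : Φ 1 = 1) (X : A) : schwarzDefect Φ X =
    ∑ i, ∑ j, star (![1, -Φ X] i) * Φ (star (![X, 1] i) * ![X, 1] j) * ![1, -Φ X] j := by
  simp only [schwarzDefect, Fin.sum_univ_two, Matrix.cons_val_zero, Matrix.cons_val_one, star_one,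
    mul_one, one_mul, h1, map_star, star_neg]
  noncomm_ring

theorem schwarzDefect_nonneg (h1 : Φ 1 = 1) (X : A) : 0 ≤ schwarzDefect Φ X :=
  schwarzDefect_eq_sum h1 X ▸ sum_star_mul_map_mul_nonneg Φ ![X, 1] ![1, -Φ X]

theorem schwarzDefect_add_le (h1 : Φ 1 = 1) (X Y : A) :
    schwarzDefect Φ (X + Y) ≤ 2 • (schwarzDefect Φ X + schwarzDefect Φ Y) := by
  rw [← sub_nonneg]
  refine (schwarzDefect_nonneg h1 (X - Y)).trans_eq ?_
  simp only [schwarzDefect, star_add, star_sub, mul_add, add_mul, mul_sub, sub_mul, map_add,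
    map_sub]
  abel

-- With `Φ = V* π V`, this is `|a + b|² ≤ 2 (|a|² + |b|²)` for the splitting
-- `π(XY) V - V Φ(X) Φ(Y) = π(X) (π(Y) V - V Φ(Y)) + (π(X) V - V Φ(X)) Φ(Y)`.
theorem schwarzDefect_mul_le (h1 : Φ 1 = 1) (X Y : A) :
    schwarzDefect Φ (X * Y) ≤ 2 • (((‖X‖ ^ 2 : ℝ) : ℂ) • schwarzDefect Φ Y
      + star (Φ Y) * schwarzDefect Φ X * Φ Y) := by
  have hfirst := sum_star_mul_map_mul_le Φ X ![Y, 1] ![1, -Φ Y]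
  have hdiff := sum_star_mul_map_mul_nonneg Φ ![X * Y, X, 1] ![1, -(2 • Φ Y), Φ X * Φ Y]
  have hproj : 0 ≤ star (Φ X * Φ Y - Φ (X * Y)) * (Φ X * Φ Y - Φ (X * Y)) :=
    star_mul_self_nonneg _
  rw [← schwarzDefect_eq_sum h1, ← sub_nonneg] at hfirst
  rw [← sub_nonneg]
  refine (add_nonneg (add_nonneg (nsmul_nonneg hfirst 2) hdiff) hproj).trans_eq ?_
  simp only [schwarzDefect, Fin.sum_univ_two, Fin.sum_univ_three, Matrix.cons_val, star_one,
    mul_one, one_mul, h1, star_neg, map_star, star_mul, star_sub, star_nsmul, mul_sub, sub_mul,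
    mul_neg, neg_mul, mul_smul_comm, smul_mul_assoc, mul_assoc]
  abel

end SchwarzDefect

theorem star_mul_mem_of_forall_star_mul_self_mem {R : Type*} [NonUnitalRing R] [StarRing R]
    [Module ℂ R] [IsScalarTower ℂ R R] [SMulCommClass ℂ R R] [StarModule ℂ R]
    {D V : Submodule ℂ R} (hV : ∀ a ∈ V, star a * a ∈ D) {a b : R} (ha : a ∈ V) (hb : b ∈ V) :
    star a * b ∈ D := by
  have hpolar : star a * b = (4 : ℂ)⁻¹ • ((star (a + b) * (a + b) - star (a - b) * (a - b))
      - Complex.I • (star (a + Complex.I • b) * (a + Complex.I • b)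
        - star (a - Complex.I • b) * (a - Complex.I • b))) := by
    have hI (x : R) : Complex.I • Complex.I • x = -x := by
      rw [smul_smul, Complex.I_mul_I, neg_one_smul]
    simp only [star_add, star_sub, star_smul, RCLike.star_def, Complex.conj_I, mul_add, add_mul,
      mul_sub, sub_mul, neg_mul, smul_mul_assoc, mul_smul_comm, neg_smul, smul_add, smul_sub,
      smul_neg, hI, neg_neg]
    module
  have hIb := V.smul_mem Complex.I hb
  rw [hpolar]
  exact D.smul_mem _ (D.sub_mem (D.sub_mem (hV _ (V.add_mem ha hb)) (hV _ (V.sub_mem ha hb)))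
    (D.smul_mem _ (D.sub_mem (hV _ (V.add_mem ha hIb)) (hV _ (V.sub_mem ha hIb)))))

namespace QuantumMarkovSemigroup

variable {H : Type*} [NormedAddCommGroup H] [InnerProductSpace ℂ H] [CompleteSpace H]
  {S : QuantumMarkovSemigroup H} {A B : H →L[ℂ] H}

theorem HasGenerator.star (hAB : S.HasGenerator A B) : S.HasGenerator (star A) (star B) :=
  (SigmaWeakTendsto.star hAB).congr fun t => by
    simp only [star_smul, star_sub, star_inv₀, RCLike.star_def, Complex.conj_ofReal, map_star]

theorem star_mem_domain (hA : A ∈ S.generator.domain) : star A ∈ S.generator.domain :=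
  ⟨_, (S.generator_spec ⟨A, hA⟩).star⟩

theorem isBigO_map_one (hA : A ∈ S.generator.domain) :
    (fun t => S.map t A) =O[𝓝[>] 0] fun _ => (1 : ℝ) := by
  have hcoe : NNReal.toReal =O[𝓝[>] 0] fun _ => (1 : ℝ) :=
    ((NNReal.continuous_coe.tendsto 0).mono_left nhdsWithin_le_nhds).isBigO_one ℝ
  simpa using ((S.mem_domain_iff_isBigO.mp hA).trans hcoe).add
    (Asymptotics.isBigO_const_const A (one_ne_zero (α := ℝ)) _)

theorem star_mul_self_mem_domain_iff (hA : A ∈ S.generator.domain) :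
    star A * A ∈ S.generator.domain ↔
      (fun t => schwarzDefect (S.map t) A) =O[𝓝[>] 0] NNReal.toReal := by
  have hsq : (fun t => star (S.map t A) * S.map t A - star A * A) =O[𝓝[>] 0] NNReal.toReal := by
    have hleft := (S.mem_domain_iff_isBigO.mp (star_mem_domain hA)).mul (isBigO_map_one hA)
    have hright := (Asymptotics.isBigO_const_const (star A) (one_ne_zero (α := ℝ)) _).mul
      (S.mem_domain_iff_isBigO.mp hA)
    simp only [mul_one, one_mul] at hleft hright
    refine (hleft.add hright).congr_left fun t => ?_
    rw [map_star]
    noncomm_ring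
  rw [mem_domain_iff_isBigO]
  refine ⟨fun h => (h.sub hsq).congr_left fun t => ?_, fun h => (h.add hsq).congr_left fun t => ?_⟩
  all_goals rw [schwarzDefect]; abel

theorem isBigO_schwarzDefect_of_le {F : ℝ≥0 → H →L[ℂ] H} (hF : F =O[𝓝[>] 0] NNReal.toReal)
    (h : ∀ t, schwarzDefect (S.map t) A ≤ F t) :
    (fun t => schwarzDefect (S.map t) A) =O[𝓝[>] 0] NNReal.toReal :=
  .trans (.of_norm_le fun t => CStarAlgebra.norm_le_norm_of_nonneg_of_le
    (schwarzDefect_nonneg (S.map_one t) A) (h t)) hF.norm_left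

variable (S) in
/-- The operators `A` such that `A` and `A* A` lie in the domain of the generator. -/
def leftDomain : Submodule ℂ (H →L[ℂ] H) where
  carrier := {A | A ∈ S.generator.domain ∧ star A * A ∈ S.generator.domain}
  add_mem' {A B} := by
    rintro ⟨hA, hAA⟩ ⟨hB, hBB⟩
    refine ⟨add_mem hA hB, (star_mul_self_mem_domain_iff (add_mem hA hB)).mpr ?_⟩
    have hadd := ((star_mul_self_mem_domain_iff hA).mp hAA).add
      ((star_mul_self_mem_domain_iff hB).mp hBB)
    refine isBigO_schwarzDefect_of_le ?_ fun t => schwarzDefect_add_le (S.map_one t) A B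
    simpa only [two_smul] using hadd.add hadd
  zero_mem' := by simp
  smul_mem' c A := by
    rintro ⟨hA, hAA⟩
    refine ⟨Submodule.smul_mem _ c hA, ?_⟩
    simpa only [star_smul, smul_mul_assoc, mul_smul_comm] using
      Submodule.smul_mem _ _ (Submodule.smul_mem _ _ hAA)

theorem star_mul_mem_domain (hA : A ∈ S.leftDomain) (hB : B ∈ S.leftDomain) :
    star A * B ∈ S.generator.domain :=
  star_mul_mem_of_forall_star_mul_self_mem (V := S.leftDomain) (fun _ h => h.2) hA hB

theorem mul_mem_leftDomain (hA : A ∈ S.leftDomain) (hB : B ∈ S.leftDomain)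
    (hAB : A * B ∈ S.generator.domain) : A * B ∈ S.leftDomain := by
  refine ⟨hAB, (star_mul_self_mem_domain_iff hAB).mpr ?_⟩
  have hDA := (star_mul_self_mem_domain_iff hA.1).mp hA.2
  have hDB := (star_mul_self_mem_domain_iff hB.1).mp hB.2
  have hconj := ((isBigO_map_one (star_mem_domain hB.1)).mul hDA).mul (isBigO_map_one hB.1)
  simp only [one_mul, mul_one, map_star] at hconj
  have hsum := (hDB.const_smul_left ((‖A‖ ^ 2 : ℝ) : ℂ)).add hconj
  refine isBigO_schwarzDefect_of_le ?_ fun t => schwarzDefect_mul_le (S.map_one t) A B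
  simpa only [two_smul, Pi.smul_apply] using hsum.add hsum

variable (S) in
/-- The operators `A` such that `A`, `A* A` and `A A*` lie in the domain of the generator, as a
`*`-algebra; the condition on `A A*` is the one on `A* A` for `A*`. -/
def squareDomain : NonUnitalStarSubalgebra ℂ (H →L[ℂ] H) where
  carrier := {A | A ∈ S.leftDomain ∧ star A ∈ S.leftDomain}
  add_mem' hA hB := ⟨add_mem hA.1 hB.1, by rw [star_add]; exact add_mem hA.2 hB.2⟩
  zero_mem' := by simp
  smul_mem' c A hA :=
    ⟨Submodule.smul_mem _ c hA.1, by rw [star_smul]; exact Submodule.smul_mem _ _ hA.2⟩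
  mul_mem' {A B} := by
    rintro ⟨hA, hA'⟩ ⟨hB, hB'⟩
    have hAB : A * B ∈ S.generator.domain := by simpa using star_mul_mem_domain hA' hB
    have hBA := star_mem_domain hAB
    refine ⟨mul_mem_leftDomain hA hB hAB, ?_⟩
    rw [star_mul] at hBA ⊢
    exact mul_mem_leftDomain hB' hA' hBA
  star_mem' hA := ⟨hA.2, by rw [star_star]; exact hA.1⟩

theorem mem_squareDomain_iff : A ∈ S.squareDomain ↔ A ∈ S.generator.domain ∧
    star A * A ∈ S.generator.domain ∧ A * star A ∈ S.generator.domain := by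
  refine ⟨fun ⟨h, h'⟩ => ⟨h.1, h.2, by simpa using h'.2⟩, fun ⟨h, h', h''⟩ => ?_⟩
  exact ⟨⟨h, h'⟩, star_mem_domain h, by simpa using h''⟩

theorem isGreatest_squareDomain : IsGreatest S.starSubalgebrasInDomain S.squareDomain :=
  ⟨fun _ hA => (mem_squareDomain_iff.mp hA).1, fun _ h𝒜 _ hA => mem_squareDomain_iff.mpr
    ⟨h𝒜 _ hA, h𝒜 _ (mul_mem (star_mem hA) hA), h𝒜 _ (mul_mem hA (star_mem hA))⟩⟩

variable (S) in
theorem domainAlgebra_eq_squareDomain : S.domainAlgebra = S.squareDomain :=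
  isGreatest_squareDomain.isLUB.sSup_eq

variable (S) in
theorem isGreatest_domainAlgebra : IsGreatest S.starSubalgebrasInDomain S.domainAlgebra :=
  S.domainAlgebra_eq_squareDomain ▸ isGreatest_squareDomain

theorem mem_domainAlgebra_iff : A ∈ S.domainAlgebra ↔ A ∈ S.generator.domain ∧
    star A * A ∈ S.generator.domain ∧ A * star A ∈ S.generator.domain :=
  S.domainAlgebra_eq_squareDomain ▸ mem_squareDomain_iff

end QuantumMarkovSemigroup

section RankOne

open InnerProductSpace (rankOne)

variable {H : Type*} [NormedAddCommGroup H] [InnerProductSpace ℂ H] [CompleteSpace H]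

-- Complete positivity is tested on the conjugate of the matrix with four blocks `M` by the diagonal
-- matrix with entries `1` and `|uᵢ⟩⟨w|`, in the direction of the vector with entries `uᵢ` and `-h`.
theorem sum_inner_map_rankOne_nonneg {ι : Type*} [Fintype ι] (Φ : (H →L[ℂ] H) →CP (H →L[ℂ] H))
    {M : CStarMatrix ι ι (H →L[ℂ] H)} (hM : 0 ≤ M) (u : ι → H) (w h : H) :
    0 ≤ ∑ i, ∑ j, (⟪u i, Φ (M i j) (u j)⟫_ℂ - ⟪u i, Φ (rankOne ℂ (M i j (u j)) w) h⟫_ℂ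
      - ⟪Φ (rankOne ℂ (star (M i j) (u i)) w) h, u j⟫_ℂ
      + ⟪u i, M i j (u j)⟫_ℂ * ⟪h, Φ (rankOne ℂ w w) h⟫_ℂ) := by
  have hblock := star_mul_submatrix_mul_nonneg hM (Sum.elim id id)
    (Sum.elim (fun _ => 1) fun j => rankOne ℂ (u j) w)
  have hright (A : H →L[ℂ] H) (x : H) : A * rankOne ℂ x w = rankOne ℂ (A x) w :=
    InnerProductSpace.comp_rankOne _ _ _
  have hleft (A : H →L[ℂ] H) (x : H) : star (rankOne ℂ x w) * A =
      star (rankOne ℂ (star A x) w) := by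
    rw [← hright, star_mul, star_star]
  have happly (x y : H) : star (rankOne ℂ x w) y = ⟪x, y⟫_ℂ • w := by
    rw [ContinuousLinearMap.star_eq_adjoint, InnerProductSpace.adjoint_rankOne,
      InnerProductSpace.rankOne_apply]
  have hadj (A : H →L[ℂ] H) (x y : H) : ⟪x, star A y⟫_ℂ = ⟪A x, y⟫_ℂ :=
    ContinuousLinearMap.adjoint_inner_right _ _ _
  have hadj' (A : H →L[ℂ] H) (x y : H) : ⟪star A x, y⟫_ℂ = ⟪x, A y⟫_ℂ :=
    ContinuousLinearMap.adjoint_inner_left _ _ _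
  refine (sum_inner_apply_nonneg (Φ.map_cstarMatrix_nonneg _ hblock)
    (Sum.elim u fun _ => -h)).trans_eq ?_
  simp only [Fintype.sum_sum_type, Sum.elim_inl, Sum.elim_inr, CStarMatrix.map_apply,
    CStarMatrix.ofMatrix_apply, Matrix.of_apply, id, star_one, one_mul, mul_one, hright, hleft,
    happly, hadj', map_star, map_smul, smul_apply, _root_.map_neg, inner_neg_left, inner_neg_right,
    mul_neg, hadj, inner_smul_right, Finset.sum_add_distrib, Finset.sum_sub_distrib,
    Finset.sum_neg_distrib]
  ring

theorem rankOne_le_of_inner_eq_one {T : H →L[ℂ] H} (hT : T.IsPositive) {h : H}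
    (hh : ⟪T h, h⟫_ℂ = 1) : rankOne ℂ (T h) (T h) ≤ T := by
  obtain ⟨D, hD⟩ := exists_eq_star_mul_self_of_nonneg
    ((ContinuousLinearMap.nonneg_iff_isPositive T).mpr hT)
  have hinner (x y : H) : ⟪T x, y⟫_ℂ = ⟪D x, D y⟫_ℂ := by
    rw [hD, mul_apply_eq_comp, ContinuousLinearMap.star_eq_adjoint,
      ContinuousLinearMap.adjoint_inner_left]
  have hnorm : ‖D h‖ = 1 := by
    refine (pow_eq_one_iff_of_nonneg (norm_nonneg _) two_ne_zero).mp ?_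
    rw [← inner_self_eq_norm_sq (𝕜 := ℂ), ← hinner, hh, RCLike.one_re]
  rw [ContinuousLinearMap.le_def, ContinuousLinearMap.isPositive_iff_complex]
  intro x
  have hval : ⟪(T - rankOne ℂ (T h) (T h)) x, x⟫_ℂ
      = ((‖D x‖ ^ 2 - ‖⟪D h, D x⟫_ℂ‖ ^ 2 : ℝ) : ℂ) := by
    rw [sub_apply, inner_sub_left, hinner, inner_self_eq_norm_sq_to_K,
      InnerProductSpace.rankOne_apply, inner_smul_left, hinner, RCLike.conj_mul]
    push_cast
    rfl
  have hCS : ‖⟪D h, D x⟫_ℂ‖ ≤ ‖D x‖ := by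
    simpa only [hnorm, one_mul] using norm_inner_le_norm (𝕜 := ℂ) (D h) (D x)
  rw [hval]
  exact ⟨rfl, sub_nonneg.mpr (pow_le_pow_left₀ (norm_nonneg _) hCS 2)⟩

end RankOne

theorem IsAssociateVector.inner_eq_one {H : Type*} [NormedAddCommGroup H] [InnerProductSpace ℂ H]
    {T : H →L[ℂ] H} {h : H} (hh : IsAssociateVector T h) (hT : T ≠ 0) : ⟪T h, h⟫_ℂ = 1 := by
  obtain ⟨m, k', t', k, hk', ht', rfl, hk, rfl⟩ := hh
  set τ : ℝ := ∑ r, t' r with hτ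
  have hτ0 : 0 < τ := by
    have : Nonempty (Fin m) := not_isEmpty_iff.mp fun _ => hT (Fintype.sum_empty _)
    exact Finset.sum_pos (fun s _ => ht' s) Finset.univ_nonempty
  have hcoef (s : Fin m) : ((‖k s‖ ^ 2 : ℂ))⁻¹ • k s = ((τ⁻¹ * √τ : ℝ) : ℂ) • k' s := by
    have hnorm : ‖k s‖ ^ 2 = τ := by
      rw [hk, norm_smul, hk'.1 s, mul_one, Complex.norm_real,
        Real.norm_of_nonneg (Real.sqrt_nonneg _), Real.sq_sqrt hτ0.le]
    rw [← Complex.ofReal_pow, hnorm, hk, smul_smul, Complex.ofReal_mul, Complex.ofReal_inv]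
  have hc : (τ⁻¹ * √τ) * (τ⁻¹ * √τ) * τ = 1 := by
    rw [mul_mul_mul_comm, Real.mul_self_sqrt hτ0.le]
    field_simp
  simp only [hcoef, sum_apply, smul_apply, InnerProductSpace.rankOne_apply,
    hk'.inner_right_fintype, sum_inner, inner_smul_left, Complex.conj_ofReal]
  rw [← Finset.sum_mul, mul_comm, ← Complex.ofReal_sum, ← hτ]
  exact_mod_cast hc

namespace QuantumMarkovSemigroup

open InnerProductSpace (rankOne)

variable {H : Type*} [NormedAddCommGroup H] [InnerProductSpace ℂ H] [CompleteSpace H]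
  {S : QuantumMarkovSemigroup H} {A B : H →L[ℂ] H}

theorem HasGenerator.inner (hAB : S.HasGenerator A B) (u v : H) :
    Tendsto (fun t : ℝ≥0 => ((t : ℝ) : ℂ)⁻¹ * (⟪u, S.map t A v⟫_ℂ - ⟪u, A v⟫_ℂ)) (𝓝[>] 0)
      (𝓝 ⟪u, B v⟫_ℂ) := by
  simpa only [smul_apply, sub_apply, inner_smul_right, inner_sub_right] using
    SigmaWeakTendsto.inner hAB u v

theorem HasGenerator.inner_left (hAB : S.HasGenerator A B) (u v : H) :
    Tendsto (fun t : ℝ≥0 => ((t : ℝ) : ℂ)⁻¹ * (⟪S.map t A u, v⟫_ℂ - ⟪A u, v⟫_ℂ)) (𝓝[>] 0)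
      (𝓝 ⟪B u, v⟫_ℂ) := by
  have hstar := hAB.star.inner u v
  simp only [map_star] at hstar
  simpa only [ContinuousLinearMap.star_eq_adjoint, ContinuousLinearMap.adjoint_inner_right]
    using hstar

theorem HasGenerator.isSelfAdjoint (hAB : S.HasGenerator A B) (hA : IsSelfAdjoint A) :
    IsSelfAdjoint B := by
  have hstar := hAB.star
  rw [hA.star_eq] at hstar
  exact hstar.unique hAB

theorem HasGenerator.inner_le_of_le {A' B' : H →L[ℂ] H} (hAB : S.HasGenerator A B)
    (hAB' : S.HasGenerator A' B') (hle : A ≤ A') {h : H} (hh : ⟪h, A h⟫_ℂ = ⟪h, A' h⟫_ℂ) :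
    ⟪h, B h⟫_ℂ ≤ ⟪h, B' h⟫_ℂ := by
  refine le_of_tendsto_of_tendsto' (hAB.inner h h) (hAB'.inner h h) fun t => ?_
  have hmap : S.map t A ≤ S.map t A' := OrderHomClass.mono (S.map t) hle
  have hinner : ⟪h, S.map t A h⟫_ℂ ≤ ⟪h, S.map t A' h⟫_ℂ := by
    simpa only [sub_apply, inner_sub_right, sub_nonneg] using
      ((ContinuousLinearMap.le_def _ _).mp hmap).inner_nonneg_right h
  rw [hh]
  exact mul_le_mul_of_nonneg_left (sub_le_sub_right hinner _) (inv_coe_nonneg t)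

theorem inner_generator_rankOne_le {T : H →L[ℂ] H} (hpos : T.IsPositive)
    (hT : T ∈ S.generator.domain) {h : H} (hh : ⟪T h, h⟫_ℂ = 1)
    (hTh : rankOne ℂ (T h) (T h) ∈ S.generator.domain) :
    ⟪h, S.generator ⟨rankOne ℂ (T h) (T h), hTh⟩ h⟫_ℂ ≤ ⟪h, S.generator ⟨T, hT⟩ h⟫_ℂ := by
  refine (S.generator_spec ⟨_, hTh⟩).inner_le_of_le (S.generator_spec ⟨T, hT⟩)
    (rankOne_le_of_inner_eq_one hpos hh) ?_
  rw [InnerProductSpace.rankOne_apply, hh, one_smul]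

variable (S) in
/-- The generator restricted to the domain algebra. -/
def generatorOnDomainAlgebra : S.domainAlgebra →ₗ[ℂ] (H →L[ℂ] H) :=
  S.generator.toFun ∘ₗ
    { toFun A := ⟨A, S.isGreatest_domainAlgebra.1 A A.2⟩
      map_add' _ _ := rfl
      map_smul' _ _ := rfl }

theorem hasGenerator_generatorOnDomainAlgebra (A : S.domainAlgebra) :
    S.HasGenerator A (S.generatorOnDomainAlgebra A) :=
  S.generator_spec ⟨A, S.isGreatest_domainAlgebra.1 A A.2⟩

variable (S) in
/-- The map `u ↦ |u⟩⟨w|` into the domain algebra. -/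
def rankOneMap (w : H) : S.rankOneSubspace w →ₗ[ℂ] S.domainAlgebra where
  toFun u := ⟨rankOne ℂ (u : H) w, u.2⟩
  map_add' _ _ := Subtype.ext (by simp)
  map_smul' _ _ := Subtype.ext (by simp)

variable (S) in
/-- `S.act` as a linear map into the linear operators on `{x | |x⟩⟨w| ∈ domain algebra}`. -/
def actLinear (w : H) : S.domainAlgebra →ₗ[ℂ] S.rankOneSubspace w →ₗ[ℂ] S.rankOneSubspace w :=
  LinearMap.mk₂ ℂ S.act (fun _ _ _ => Subtype.ext (by simp [act]))
    (fun _ _ _ => Subtype.ext (by simp [act])) (fun _ _ _ => Subtype.ext (by simp [act]))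
    fun _ _ _ => Subtype.ext (by simp [act])

variable {w h : H}

-- As `⟪w, h⟫ = 1`, the undifferentiated terms of the four difference quotients cancel.
theorem sum_inner_generator_nonneg {ι : Type*} [Fintype ι] (hwh : ⟪w, h⟫_ℂ = 1)
    (hW : rankOne ℂ w w ∈ S.generator.domain) {M : ι → ι → S.domainAlgebra}
    (hM : 0 ≤ CStarMatrix.ofMatrix (Matrix.of fun i j => (M i j : H →L[ℂ] H)))
    (u : ι → S.rankOneSubspace w) :
    0 ≤ ∑ i, ∑ j, (⟪(u i : H), S.generatorOnDomainAlgebra (M i j) (u j)⟫_ℂ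
      - ⟪(u i : H), S.generatorOnDomainAlgebra (S.rankOneMap w (S.act (M i j) (u j))) h⟫_ℂ
      - ⟪S.generatorOnDomainAlgebra (S.rankOneMap w (S.act (star (M i j)) (u i))) h, (u j : H)⟫_ℂ
      + ⟪(u i : H), (M i j : H →L[ℂ] H) (u j)⟫_ℂ
        * ⟪h, S.generator ⟨rankOne ℂ w w, hW⟩ h⟫_ℂ) := by
  have hgen (i j : ι) := hasGenerator_generatorOnDomainAlgebra (M i j)
  have hright (i j : ι) := hasGenerator_generatorOnDomainAlgebra
    (S.rankOneMap w (S.act (M i j) (u j)))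
  have hleft (i j : ι) := hasGenerator_generatorOnDomainAlgebra
    (S.rankOneMap w (S.act (star (M i j)) (u i)))
  refine ge_of_tendsto' (tendsto_finsetSum .univ fun i _ => tendsto_finsetSum .univ fun j _ =>
    ((((hgen i j).inner (u i) (u j)).sub ((hright i j).inner (u i) h)).sub
      ((hleft i j).inner_left h (u j))).add
      (((S.generator_spec ⟨_, hW⟩).inner h h).const_mul _)) fun t => ?_
  refine (mul_nonneg (inv_coe_nonneg t)
    (sum_inner_map_rankOne_nonneg (S.map t) hM (fun i => (u i : H)) w h)).trans_eq ?_
  have hhw : ⟪h, w⟫_ℂ = 1 := by rw [← inner_conj_symm, hwh, _root_.map_one]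
  have hadj (i j : ι) : ⟪star (M i j : H →L[ℂ] H) (u i), (u j : H)⟫_ℂ =
      ⟪(u i : H), (M i j : H →L[ℂ] H) (u j)⟫_ℂ :=
    ContinuousLinearMap.adjoint_inner_left _ _ _
  simp only [Finset.mul_sum, CStarMatrix.ofMatrix_apply, Matrix.of_apply, rankOneMap,
    LinearMap.coe_mk, AddHom.coe_mk, act, StarMemClass.coe_star,
    InnerProductSpace.rankOne_apply, hwh, hhw, one_smul, hadj]
  refine Finset.sum_congr rfl fun i _ => Finset.sum_congr rfl fun j _ => ?_
  ring

variable (S) in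
/-- The operator `u ↦ L(|u⟩⟨w|) h - c u`. -/
def drift (w h : H) (c : ℂ) : S.rankOneSubspace w →ₗ[ℂ] H :=
  (ContinuousLinearMap.apply ℂ H h).toLinearMap ∘ₗ S.generatorOnDomainAlgebra ∘ₗ S.rankOneMap w
    - c • (S.rankOneSubspace w).subtype

/-- The form `⟪u, L(A) v⟫ - ⟪u, G A v⟫ - ⟪G A* u, v⟫`. -/
def dissipation (G : S.rankOneSubspace w →ₗ[ℂ] H) :
    S.domainAlgebra →ₗ[ℂ] (S.rankOneSubspace w →ₗ⋆[ℂ] S.rankOneSubspace w →ₗ[ℂ] ℂ) where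
  toFun A := LinearMap.mk₂'ₛₗ _ _
    (fun u v => ⟪(u : H), S.generatorOnDomainAlgebra A v⟫_ℂ
      - ⟪(u : H), G (S.actLinear w A v)⟫_ℂ - ⟪G (S.actLinear w (star A) u), (v : H)⟫_ℂ)
    (fun _ _ _ => by simp only [_root_.map_add, Submodule.coe_add, inner_add_left]; ring)
    (fun _ _ _ => by simp only [map_smul, Submodule.coe_smul, inner_smul_left, smul_eq_mul]; ring)
    (fun _ _ _ => by simp only [_root_.map_add, Submodule.coe_add, inner_add_right]; ring)
    fun _ _ _ => by
      simp only [map_smul, Submodule.coe_smul, inner_smul_right, smul_eq_mul, RingHom.id_apply]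
      ring
  map_add' _ _ := by
    ext
    simp only [LinearMap.mk₂'ₛₗ_apply, LinearMap.add_apply, _root_.map_add, star_add,
      inner_add_left, inner_add_right, add_apply]
    ring
  map_smul' _ _ := by
    ext
    simp only [LinearMap.mk₂'ₛₗ_apply, LinearMap.smul_apply, map_smul, star_smul, inner_smul_left,
      inner_smul_right, smul_apply, RingHom.id_apply, smul_eq_mul, RCLike.star_def,
      Complex.conj_conj]
    ring

theorem dissipation_apply (G : S.rankOneSubspace w →ₗ[ℂ] H) (A : S.domainAlgebra)
    (u v : S.rankOneSubspace w) :
    dissipation G A u v = ⟪(u : H), S.generatorOnDomainAlgebra A v⟫_ℂ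
      - ⟪(u : H), G (S.act A v)⟫_ℂ - ⟪G (S.act (star A) u), (v : H)⟫_ℂ :=
  rfl

theorem inner_generatorOnDomainAlgebra (G : S.rankOneSubspace w →ₗ[ℂ] H) (A : S.domainAlgebra)
    (u v : S.rankOneSubspace w) : ⟪(u : H), S.generatorOnDomainAlgebra A v⟫_ℂ =
      dissipation G A u v + ⟪(u : H), G (S.act A v)⟫_ℂ + ⟪G (S.act (star A) u), (v : H)⟫_ℂ := by
  rw [dissipation_apply]
  ring

theorem dissipation_drift_apply (c : ℂ) (A : S.domainAlgebra) (u v : S.rankOneSubspace w) :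
    dissipation (S.drift w h c) A u v = ⟪(u : H), S.generatorOnDomainAlgebra A v⟫_ℂ
      - ⟪(u : H), S.generatorOnDomainAlgebra (S.rankOneMap w (S.act A v)) h⟫_ℂ
      - ⟪S.generatorOnDomainAlgebra (S.rankOneMap w (S.act (star A) u)) h, (v : H)⟫_ℂ
      + ⟪(u : H), (A : H →L[ℂ] H) v⟫_ℂ * (c + star c) := by
  have hdrift (x : S.rankOneSubspace w) :
      S.drift w h c x = S.generatorOnDomainAlgebra (S.rankOneMap w x) h - c • (x : H) := rfl
  have hadj : ⟪(S.act (star A) u : H), (v : H)⟫_ℂ = ⟪(u : H), (A : H →L[ℂ] H) v⟫_ℂ :=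
    ContinuousLinearMap.adjoint_inner_left _ _ _
  simp only [dissipation_apply, hdrift, inner_sub_left, inner_sub_right, inner_smul_left,
    inner_smul_right, hadj, RCLike.star_def]
  simp only [act]
  ring

theorem isUCompletelyPositive_dissipation_drift (hwh : ⟪w, h⟫_ℂ = 1)
    (hW : rankOne ℂ w w ∈ S.generator.domain) {c : ℂ}
    (hc : ⟪h, S.generator ⟨rankOne ℂ w w, hW⟩ h⟫_ℂ ≤ c + star c) :
    IsUCompletelyPositive S.domainAlgebra (S.rankOneSubspace w)
      (dissipation (S.drift w h c)) := by
  intro k M hM u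
  refine (add_nonneg (sum_inner_generator_nonneg hwh hW hM u) (mul_nonneg
    (sum_inner_apply_nonneg hM fun i => (u i : H)) (sub_nonneg.mpr hc))).trans_eq ?_
  simp only [dissipation_drift_apply, Finset.sum_mul, ← Finset.sum_add_distrib,
    CStarMatrix.ofMatrix_apply, Matrix.of_apply]
  refine Finset.sum_congr rfl fun i _ => Finset.sum_congr rfl fun j _ => ?_
  ring

end QuantumMarkovSemigroup

end QMS

end

open QMS QMS.QuantumMarkovSemigroup in
theorem theorem3p9_general {H : Type*} [NormedAddCommGroup H] [InnerProductSpace ℂ H]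
    [CompleteSpace H] (S : QMS.QuantumMarkovSemigroup H)
    (T : H →L[ℂ] H) (hTpos : T.IsPositive) (hT : T ∈ S.generator.domain)
    (h : H) (hh : ⟪T h, h⟫_ℂ = 1)
    (hTh : InnerProductSpace.rankOne ℂ (T h) (T h) ∈ S.generator.domain) :
    IsGreatest S.starSubalgebrasInDomain S.domainAlgebra ∧
    (∀ A : H →L[ℂ] H, A ∈ S.domainAlgebra ↔ A ∈ S.generator.domain ∧
      star A * A ∈ S.generator.domain ∧ A * star A ∈ S.generator.domain) ∧
    ∃ (hD : ∀ A ∈ S.domainAlgebra, A ∈ S.generator.domain)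
      (G : S.rankOneSubspace (T h) →ₗ[ℂ] H)
      (φ : S.domainAlgebra →ₗ[ℂ]
        (S.rankOneSubspace (T h) →ₗ⋆[ℂ] S.rankOneSubspace (T h) →ₗ[ℂ] ℂ)),
      (∀ u : S.rankOneSubspace (T h),
        G u = S.generator ⟨InnerProductSpace.rankOne ℂ (u : H) (T h), hD _ u.2⟩ h
          - ((1 / 2 : ℂ) * ⟪h, S.generator ⟨T, hT⟩ h⟫_ℂ) • (u : H)) ∧
      QMS.IsUCompletelyPositive S.domainAlgebra (S.rankOneSubspace (T h)) φ ∧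
      ∀ (A : S.domainAlgebra) (u v : S.rankOneSubspace (T h)),
        ⟪(u : H), S.generator ⟨(A : H →L[ℂ] H), hD _ A.2⟩ (v : H)⟫_ℂ
          = φ A u v + ⟪(u : H), G (S.act A v)⟫_ℂ + ⟪G (S.act (star A) u), (v : H)⟫_ℂ := by
  set c := (1 / 2 : ℂ) * ⟪h, S.generator ⟨T, hT⟩ h⟫_ℂ with hc
  have hreal : star ⟪h, S.generator ⟨T, hT⟩ h⟫_ℂ = ⟪h, S.generator ⟨T, hT⟩ h⟫_ℂ :=
    (inner_conj_symm _ _).trans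
      (((S.generator_spec ⟨T, hT⟩).isSelfAdjoint hTpos.isSelfAdjoint).isSymmetric h h)
  have hadd : c + star c = ⟪h, S.generator ⟨T, hT⟩ h⟫_ℂ := by
    rw [hc, star_mul, hreal, star_div₀, star_one, star_ofNat]
    ring
  refine ⟨S.isGreatest_domainAlgebra, fun A => mem_domainAlgebra_iff, S.isGreatest_domainAlgebra.1,
    S.drift (T h) h c, dissipation (S.drift (T h) h c), fun u => rfl,
    isUCompletelyPositive_dissipation_drift hh hTh ?_, inner_generatorOnDomainAlgebra _⟩
  exact (inner_generator_rankOne_le hTpos hT hh hTh).trans_eq hadd.symm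

theorem theorem3p9 {H : Type*} [NormedAddCommGroup H] [InnerProductSpace ℂ H] [CompleteSpace H]
    (S : QMS.QuantumMarkovSemigroup H)
    (T : H →L[ℂ] H) (hTpos : T.IsPositive)
    (hTfin : FiniteDimensional ℂ (LinearMap.range (T : H →ₗ[ℂ] H))) (hT0 : T ≠ 0)
    (hT : T ∈ S.generator.domain)
    (h : H) (hh : QMS.IsAssociateVector T h)
    (hTh : InnerProductSpace.rankOne ℂ (T h) (T h) ∈ S.generator.domain) :
    -- the domain algebra is the largest `*`-subalgebra of `D(L)`, and its explicit description
    IsGreatest S.starSubalgebrasInDomain S.domainAlgebra ∧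
    (∀ A : H →L[ℂ] H, A ∈ S.domainAlgebra ↔ A ∈ S.generator.domain ∧
      star A * A ∈ S.generator.domain ∧ A * star A ∈ S.generator.domain) ∧
    -- the operator `G`, the map `φ` and the form of the generator
    ∃ (hD : ∀ A ∈ S.domainAlgebra, A ∈ S.generator.domain)
      (G : S.rankOneSubspace (T h) →ₗ[ℂ] H)
      (φ : S.domainAlgebra →ₗ[ℂ]
        (S.rankOneSubspace (T h) →ₗ⋆[ℂ] S.rankOneSubspace (T h) →ₗ[ℂ] ℂ)),
      (∀ u : S.rankOneSubspace (T h),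
        G u = S.generator ⟨InnerProductSpace.rankOne ℂ (u : H) (T h), hD _ u.2⟩ h
          - ((1 / 2 : ℂ) * ⟪h, S.generator ⟨T, hT⟩ h⟫_ℂ) • (u : H)) ∧
      QMS.IsUCompletelyPositive S.domainAlgebra (S.rankOneSubspace (T h)) φ ∧
      ∀ (A : S.domainAlgebra) (u v : S.rankOneSubspace (T h)),
        ⟪(u : H), S.generator ⟨(A : H →L[ℂ] H), hD _ A.2⟩ (v : H)⟫_ℂ
          = φ A u v + ⟪(u : H), G (S.act A v)⟫_ℂ + ⟪G (S.act (star A) u), (v : H)⟫_ℂ := by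
  exact theorem3p9_general S T hTpos hT h (hh.inner_eq_one hT0) hTh
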